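/- Let $\Gamma$ be a countable (possibly finite) abelian group, written additively. For a finite discrete set $A$, let $\Gamma$ act on $A^\Gamma$ (product topology) by $\sigma_w(x)_v=x_{v+w}$. A $\Gamma$-subshift is a (possibly empty) closed shift-invariant subset of $A^\Gamma$ for some finite set $A$; a map between $\Gamma$-subshifts is a continuous $\Gamma$-equivariant function, and an embedding is an injective map. For $x\in A^\Gamma$ put $\mathrm{stab}(x)=\{v\in\Gamma:\sigma_v(x)=x\}$. A $\Gamma$-subshift $Y$ has the map extension property if, for every $\Gamma$-subshift $X$ such that for each $x\in X$ there is $y\in Y$ with $\mathrm{stab}(x)\le\mathrm{stab}(y)$, and for every (possibly empty) $\Gamma$-subshift $\tilde X\subseteq X$, every map $\tilde\pi:\tilde X\to Y$ extends to a map $\pi:X\to Y$. For a finite set $\mathcal G$ of subgroups of $\Gamma$, a $\Gamma$-subshift $X$ is $\mathcal G$-free if $\Gamma_0\not\subseteq\mathrm{stab}(x)$ for all $x\in X$ and all $\Gamma_0\in\mathcal G$. If $Y\subseteq X$ are $\Gamma$-subshifts, $Y$ is a retract of $X$ if there is a map $r:X\to Y$ whose restriction to $Y$ is the identity. A $\Gamma$-subshift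 $Y$ is an absolute retract for the class of $\mathcal G$-free $\Gamma$-subshifts if $Y$ is $\mathcal G$-free and, for every $\mathcal G$-free $\Gamma$-subshift $X$ and every embedding $e:Y\to X$, the image $e(Y)$ is a retract of $X$. **Proposition.** A $\Gamma$-subshift $Y$ has the map extension property if and only if there exists a finite set $\mathcal G$ of subgroups of $\Gamma$ such that $Y$ is an absolute retract for the class of $\mathcal G$-free $\Gamma$-subshifts. -/

import Mathlib

open SymbolicDynamics.FullShift

namespace SubshiftRetract

universe u v

variable {Γ : Type v} [AddCommGroup Γ]

/-- The stabilizer `stab(x) = {v ∈ Γ : σ_v(x) = x}` of a configuration `x ∈ A^Γ`. -/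
def stab {A : Type u} (x : Γ → A) : AddSubgroup Γ where
  carrier := {w | shift w x = x}
  zero_mem' := shift_zero x
  add_mem' := by
    intro a b ha hb
    change shift (a + b) x = x
    rw [shift_add, show shift a x = x from ha, show shift b x = x from hb]
  neg_mem' := by
    intro a ha
    change shift (-a) x = x
    conv_lhs => rw [← show shift a x = x from ha]
    rw [← shift_add, add_neg_cancel, shift_zero]

/-- A map between `Γ`-subshifts: a continuous `Γ`-equivariant function. -/
structure SubshiftMap {A B : Type u} [TopologicalSpace A] [TopologicalSpace B]
    (X : Subshift A Γ) (Y : Subshift B Γ) where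
  toFun : X.carrier → Y.carrier
  continuous_toFun : Continuous toFun
  equivariant : ∀ (g : Γ) (x : X.carrier),
    (toFun ⟨shift g x.1, X.mapsTo g x.2⟩ : Γ → B) = shift g (toFun x : Γ → B)

/-- An embedding of subshifts is an injective map. -/
def SubshiftMap.IsEmbedding {A B : Type u} [TopologicalSpace A] [TopologicalSpace B]
    {X : Subshift A Γ} {Y : Subshift B Γ} (e : SubshiftMap X Y) : Prop :=
  Function.Injective e.toFun

/-- The image of a subshift under a map, as a subshift of the target full shift. -/
def SubshiftMap.range {A B : Type u} [Finite A] [TopologicalSpace A] [TopologicalSpace B]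
    [DiscreteTopology B] {X : Subshift A Γ} {Y : Subshift B Γ} (e : SubshiftMap X Y) :
    Subshift B Γ where
  carrier := Set.range fun x : X.carrier => (e.toFun x : Γ → B)
  isClosed := by
    have : CompactSpace X.carrier := isCompact_iff_compactSpace.mp X.isClosed.isCompact
    exact (isCompact_range (continuous_subtype_val.comp e.continuous_toFun)).isClosed
  mapsTo := by
    rintro g _ ⟨x, rfl⟩
    exact ⟨⟨shift g x.1, X.mapsTo g x.2⟩, e.equivariant g x⟩

/-- The relation `X ⇝ Y`: every `x ∈ X` admits `y ∈ Y` with `stab(x) ≤ stab(y)`. -/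
def StabDominated {A B : Type u} [TopologicalSpace A] [TopologicalSpace B]
    (X : Subshift A Γ) (Y : Subshift B Γ) : Prop :=
  ∀ x ∈ X.carrier, ∃ y ∈ Y.carrier, stab x ≤ stab y

/-- The map extension property: whenever `X ⇝ Y`, every map to `Y` from a (possibly empty)
subshift `X' ⊆ X` extends to a map `X → Y`. -/
def MapExtensionProperty {A : Type u} [TopologicalSpace A] (Y : Subshift A Γ) : Prop :=
  ∀ (B : Type u) [Finite B] [TopologicalSpace B] [DiscreteTopology B] (X X' : Subshift B Γ)
    (hX' : X'.carrier ⊆ X.carrier), StabDominated X Y →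
    ∀ p' : SubshiftMap X' Y, ∃ p : SubshiftMap X Y,
      ∀ (x : Γ → B) (hx : x ∈ X'.carrier), p.toFun ⟨x, hX' hx⟩ = p'.toFun ⟨x, hx⟩

/-- `Y` is a retract of `X`: `Y ⊆ X` and some map `r : X → Y` restricts to the identity on `Y`. -/
def IsRetract {A : Type u} [TopologicalSpace A] (Y X : Subshift A Γ) : Prop :=
  ∃ (hYX : Y.carrier ⊆ X.carrier) (r : SubshiftMap X Y),
    ∀ (y : Γ → A) (hy : y ∈ Y.carrier), (r.toFun ⟨y, hYX hy⟩ : Γ → A) = y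

/-- A class of `Γ`-subshifts over finite discrete alphabets. -/
abbrev SubshiftClass (Γ : Type v) [AddCommGroup Γ] :=
  ∀ (B : Type u) [Finite B] [TopologicalSpace B] [DiscreteTopology B], Subshift B Γ → Prop

/-- `Y` is an absolute retract for the class `C`: `Y ∈ C`, and for every embedding of `Y` in some
`X ∈ C` the embedded copy of `Y` is a retract of `X`. -/
def IsAbsoluteRetractFor (C : SubshiftClass.{u} Γ) {A : Type u} [Finite A] [TopologicalSpace A]
    [DiscreteTopology A] (Y : Subshift A Γ) : Prop :=
  C A Y ∧
    ∀ (B : Type u) [Finite B] [TopologicalSpace B] [DiscreteTopology B] (X : Subshift B Γ),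
      C B X → ∀ e : SubshiftMap Y X, e.IsEmbedding → IsRetract e.range X

/-- The class of `𝒢`-free `Γ`-subshifts: no subgroup in `𝒢` is contained in the stabilizer of a
point. -/
def GFree (𝒢 : Set (AddSubgroup Γ)) : SubshiftClass.{u} Γ :=
  fun _ _ _ _ X => ∀ x ∈ X.carrier, ∀ Γ₀ ∈ 𝒢, ¬ Γ₀ ≤ stab x

end SubshiftRetract

/-! Call a subgroup forbidden if it fixes no point of `Y`. Forbidden subgroups are closed upwards,
and the theorem hinges on whether finitely many of them lie below all the others.

If they do, those finitely many form `𝒢`: a `𝒢`-free `X` has no forbidden stabilizer, so it is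
dominated by `Y`, and the inverse of an embedding of `Y` extends to `X`. If they do not, a
compactness argument (`exists_limit_subgroup`) gives forbidden `N` agreeing on any prescribed finite
set with a subgroup `H` that fixes some `y` in `Y`. Place `N`-periodic patterns on larger and larger
finite windows over the background `y`. A block code into `Y` would have to produce a point looking
`N`-periodic on a large finite region, which no point of `Y` does. To keep the orbit closure
dominated by `Y`, the patterns must have no periods outside `H` in the limit.
`exists_periodic_coloring` supplies them: a counting argument in `Γ ⧸ N` when `H` has infinite
index, a direct algebraic coloring when the index is finite.

Conversely, let `Y` be an absolute retract for `𝒢`-free subshifts and let `p'` be a map to be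
extended. The space `X` need not be `𝒢`-free, but it can be recoded as a `𝒢`-free subshift
containing a copy of `Y`, in such a way that points of the small subshift go to their `p'`-images.
Retracting onto the copy extends `p'`. -/

namespace SubshiftRetract

universe u v

/-! ### Compactness and finite windows -/

section Windows

/-- Two continuous families of configurations that differ at every point of a compact set
are told apart by finitely many coordinates. -/
theorem exists_finset_separating {T ι B : Type*} [TopologicalSpace T] [TopologicalSpace B]
    [DiscreteTopology B] {K : Set T} (hK : IsCompact K) {a b : T → ι → B}
    (ha : ∀ i, Continuous fun t => a t i) (hb : ∀ i, Continuous fun t => b t i)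
    (hab : ∀ t ∈ K, a t ≠ b t) :
    ∃ E : Finset ι, ∀ t ∈ K, ∃ i ∈ E, a t i ≠ b t i := by
  obtain ⟨E, hE⟩ := hK.elim_finite_subcover (fun i => {t | a t i ≠ b t i})
    (fun i => isOpen_ne_fun (ha i) (hb i)) (fun t ht => by
      obtain ⟨i, hi⟩ := Function.ne_iff.mp (hab t ht)
      exact Set.mem_iUnion.mpr ⟨i, hi⟩)
  refine ⟨E, fun t ht => ?_⟩
  simpa using hE ht

variable {ι B D : Type*} [TopologicalSpace B] [DiscreteTopology B]

/-- A continuous function on a compact set of configurations with values in a discrete space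
depends on finitely many coordinates. -/
theorem exists_window {S : Set (ι → B)} (hS : IsCompact S) [TopologicalSpace D]
    [DiscreteTopology D] {f : S → D} (hf : Continuous f) :
    ∃ E : Finset ι, ∀ x y : S, (∀ i ∈ E, (x : ι → B) i = (y : ι → B) i) → f x = f y := by
  have := isCompact_iff_compactSpace.mp hS
  have hK : IsCompact {p : S × S | f p.1 ≠ f p.2} :=
    ((isClosed_discrete {q : D × D | q.1 ≠ q.2}).preimage
      ((hf.comp continuous_fst).prodMk (hf.comp continuous_snd))).isCompact
  obtain ⟨E, hE⟩ := exists_finset_separating hK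
    (a := fun p => (p.1 : ι → B)) (b := fun p => (p.2 : ι → B))
    (fun i => (continuous_apply i).comp (continuous_subtype_val.comp continuous_fst))
    (fun i => (continuous_apply i).comp (continuous_subtype_val.comp continuous_snd))
    (fun p hp h => hp (congrArg f (Subtype.ext h)))
  refine ⟨E, fun x y h => by_contra fun hne => ?_⟩
  obtain ⟨i, hi, hi'⟩ := hE (x, y) hne
  exact hi' (h i hi)

/-- `f` depends only on the coordinates in `E`. -/
def DependsOnWindow (E : Finset ι) (f : (ι → B) → D) : Prop :=
  ∀ x y, (∀ i ∈ E, x i = y i) → f x = f y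

theorem DependsOnWindow.continuous [TopologicalSpace D] {E : Finset ι} {f : (ι → B) → D}
    (hf : DependsOnWindow E f) : Continuous f :=
  ((IsLocallyConstant.iff_exists_open f).mpr fun x =>
    ⟨cylinder E x, isOpen_cylinder E x, fun _ _ => rfl, fun y hy => hf y x hy⟩).continuous

/-- Patterns on the window that do not occur in `S` receive an arbitrary value. A local rule found
on a small subshift thereby acts on the whole full shift. -/
theorem exists_dependsOnWindow_extension {S : Set (ι → B)} (hS : IsCompact S)
    [TopologicalSpace D] [DiscreteTopology D] [Nonempty D] {f : S → D} (hf : Continuous f) :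
    ∃ (E : Finset ι) (F : (ι → B) → D), DependsOnWindow E F ∧ ∀ x : S, F x = f x := by
  classical
  obtain ⟨E, hE⟩ := exists_window hS hf
  let G : (E → B) → D := fun r =>
    if h : ∃ s : S, (fun i : E => (s : ι → B) i) = r then f h.choose else Classical.arbitrary D
  refine ⟨E, fun x => G fun i => x i, fun x y h => ?_, fun x => ?_⟩
  · exact congrArg G (funext fun i => h i i.2)
  · have h : ∃ s : S, (fun i : E => (s : ι → B) i) = fun i : E => (x : ι → B) i := ⟨x, rfl⟩
    simp only [G, dif_pos h]
    exact hE _ _ fun i hi => congrFun h.choose_spec ⟨i, hi⟩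

theorem mem_closure_iff_agree {S : Set (ι → B)} {x : ι → B} :
    x ∈ closure S ↔ ∀ E : Finset ι, ∃ s ∈ S, ∀ i ∈ E, s i = x i := by
  rw [mem_closure_iff]
  constructor
  · intro h E
    obtain ⟨s, hs, hsS⟩ := h (cylinder E x) (isOpen_cylinder E x) fun _ _ => rfl
    exact ⟨s, hsS, hs⟩
  · intro h o ho hx
    obtain ⟨E, w, hw, hsub⟩ := isOpen_pi_iff.mp ho x hx
    obtain ⟨s, hsS, hs⟩ := h E
    exact ⟨s, hsub fun i hi => by rw [hs i hi]; exact (hw i hi).2, hsS⟩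

end Windows

/-! ### Sliding block codes and maps of subshifts -/

section Maps

variable {Γ : Type v} [AddCommGroup Γ]

theorem compactSpace_carrier {A : Type u} [Finite A] [TopologicalSpace A]
    (X : Subshift A Γ) : CompactSpace X.carrier :=
  isCompact_iff_compactSpace.mp X.isClosed.isCompact

theorem mem_stab {A : Type u} {x : Γ → A} {w : Γ} : w ∈ stab x ↔ ∀ v, x (w + v) = x v :=
  funext_iff

theorem isClosed_setOf_le_stab {A : Type u} [TopologicalSpace A] [DiscreteTopology A]
    (Γ₀ : AddSubgroup Γ) : IsClosed {x : Γ → A | Γ₀ ≤ stab x} := by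
  have : {x : Γ → A | Γ₀ ≤ stab x} = ⋂ (w ∈ Γ₀) (v : Γ), {x | x (w + v) = x v} := by
    ext x
    simp only [Set.mem_ofPred_eq, SetLike.le_def, mem_stab, Set.mem_iInter]
  rw [this]
  exact isClosed_iInter fun w => isClosed_iInter fun _ => isClosed_iInter fun v =>
    isClosed_eq (continuous_apply _) (continuous_apply _)

/-- The sliding block code with local rule `g`. -/
def blockMap {B D : Type*} (g : (Γ → B) → D) (x : Γ → B) : Γ → D := fun v => g (shift v x)

theorem blockMap_shift {B D : Type*} (g : (Γ → B) → D) (w : Γ) (x : Γ → B) :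
    blockMap g (shift w x) = shift w (blockMap g x) :=
  funext fun v => congrArg g (shift_add w v x).symm

theorem continuous_blockMap {B D : Type*} [TopologicalSpace B] [DiscreteTopology B]
    [TopologicalSpace D] {E : Finset Γ} {g : (Γ → B) → D} (hg : DependsOnWindow E g) :
    Continuous (blockMap g) :=
  continuous_pi fun v => hg.continuous.comp (continuous_shift v)

theorem SubshiftMap.eq_blockMap {A B : Type u} [TopologicalSpace A] [TopologicalSpace B]
    {X : Subshift A Γ} {Y : Subshift B Γ} (p : SubshiftMap X Y) {g : (Γ → A) → B}
    (hg : ∀ x : X.carrier, g x = (p.toFun x : Γ → B) 0) (x : X.carrier) :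
    blockMap g x = (p.toFun x : Γ → B) := by
  funext v
  have h1 := hg ⟨shift v x.1, X.mapsTo v x.2⟩
  rw [p.equivariant v x, shift_apply, add_zero] at h1
  exact h1

/-- The composition of two maps of subshifts. -/
def SubshiftMap.comp {A B C : Type u} [TopologicalSpace A] [TopologicalSpace B]
    [TopologicalSpace C] {X : Subshift A Γ} {Y : Subshift B Γ} {Z : Subshift C Γ}
    (q : SubshiftMap Y Z) (p : SubshiftMap X Y) : SubshiftMap X Z where
  toFun x := q.toFun (p.toFun x)
  continuous_toFun := q.continuous_toFun.comp p.continuous_toFun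
  equivariant g x := by
    rw [← q.equivariant g (p.toFun x)]
    congr 2
    exact Subtype.ext (p.equivariant g x)

/-- The restriction of a continuous equivariant map of full shifts. -/
def SubshiftMap.ofMapsTo {A B : Type u} [TopologicalSpace A] [TopologicalSpace B]
    {X : Subshift A Γ} {Y : Subshift B Γ} (f : (Γ → A) → Γ → B) (hf : Continuous f)
    (hshift : ∀ g x, f (shift g x) = shift g (f x)) (h : Set.MapsTo f X.carrier Y.carrier) :
    SubshiftMap X Y where
  toFun := h.restrict
  continuous_toFun := hf.restrict h
  equivariant g x := hshift g x

/-- An embedding of subshifts is a homeomorphism onto its image. -/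
theorem SubshiftMap.exists_leftInverse {A B : Type u} [Finite A] [TopologicalSpace A]
    [TopologicalSpace B] [DiscreteTopology B] {X : Subshift A Γ} {Y : Subshift B Γ}
    (e : SubshiftMap X Y) (he : e.IsEmbedding) :
    ∃ p : SubshiftMap e.range X, ∀ y : e.range.carrier,
      (e.toFun (p.toFun y) : Γ → B) = y := by
  have := compactSpace_carrier X
  let f : X.carrier → Γ → B := fun x => (e.toFun x : Γ → B)
  have hf : Function.Injective f := Subtype.val_injective.comp he
  have hcl : Topology.IsClosedEmbedding f :=
    (continuous_subtype_val.comp e.continuous_toFun).isClosedEmbedding hf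
  let h : X.carrier ≃ₜ Set.range f := hcl.toIsEmbedding.toHomeomorph
  have hs : ∀ y : Set.range f, f (h.symm y) = y := fun y =>
    congrArg Subtype.val (h.apply_symm_apply y)
  refine ⟨⟨h.symm, h.symm.continuous, fun g y => ?_⟩, hs⟩
  have : f ⟨shift g (h.symm y).1, X.mapsTo g (h.symm y).2⟩ = shift g y.1 :=
    (e.equivariant g (h.symm y)).trans (congrArg (shift g) (hs y))
  have h2 := hf ((hs ⟨shift g y.1, e.range.mapsTo g y.2⟩).trans this.symm)
  exact congrArg Subtype.val h2

end Maps

/-! ### Absolute retracts have the map extension property -/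

section AbsoluteRetract

variable {Γ : Type v} [AddCommGroup Γ] {A : Type u} [Finite A] [TopologicalSpace A]
  [DiscreteTopology A]

/-- A point of `X` is recoded by its image under an extension of `p'`, together with its own symbols
wherever it does not look like a point of `X'`. Near `X'` the first layer rules out periods from
`𝒢`; a point never near `X'` is fully visible in the second layer, and domination by `Y` rules them
out. -/
theorem mapExtensionProperty_of_isAbsoluteRetractFor {Y : Subshift A Γ}
    {𝒢 : Set (AddSubgroup Γ)} (h𝒢 : 𝒢.Finite) (hY : IsAbsoluteRetractFor (GFree 𝒢) Y) :
    MapExtensionProperty Y := by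
  classical
  intro B _ _ _ X X' hX' hdom p'
  obtain hXe | ⟨x₀, hx₀⟩ := X.carrier.eq_empty_or_nonempty
  · have : IsEmpty X.carrier := Set.isEmpty_coe_sort.mpr hXe
    exact ⟨⟨isEmptyElim, continuous_of_const fun x => isEmptyElim x,
      fun _ x => isEmptyElim x⟩, fun x hx => (hXe ▸ hX' hx : x ∈ (∅ : Set _)).elim⟩
  obtain ⟨y₀, hy₀, -⟩ := hdom x₀ hx₀
  have : Nonempty A := ⟨y₀ 0⟩
  obtain ⟨E₀, φ, hφ, hφp⟩ := exists_dependsOnWindow_extension X'.isClosed.isCompact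
    (f := fun x => (p'.toFun x : Γ → A) 0)
    ((continuous_apply 0).comp (continuous_subtype_val.comp p'.continuous_toFun))
  have hΦ := p'.eq_blockMap hφp
  have hΦc := continuous_blockMap hφ
  -- Finiteness of `𝒢` makes this bad set closed, so finitely many coordinates separate it from
  -- `X'`; `U` is the resulting neighborhood of `X'`.
  let C : Set (Γ → B) := ⋃ Γ₀ ∈ 𝒢, {x | Γ₀ ≤ stab (blockMap φ x)}
  have hC : IsClosed C := h𝒢.isClosed_biUnion fun Γ₀ _ =>
    (isClosed_setOf_le_stab Γ₀).preimage hΦc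
  have hCX' : ∀ x ∈ C, x ∉ X'.carrier := by
    intro x hx hx'
    simp only [C, Set.mem_iUnion] at hx
    obtain ⟨Γ₀, hΓ₀, hle⟩ := hx
    rw [Set.mem_ofPred_eq, hΦ ⟨x, hx'⟩] at hle
    exact hY.1 _ (p'.toFun ⟨x, hx'⟩).2 Γ₀ hΓ₀ hle
  obtain ⟨E₁, hE₁⟩ := exists_finset_separating (hC.isCompact.prod X'.isClosed.isCompact)
    (a := Prod.fst) (b := Prod.snd) (fun i => by fun_prop) (fun i => by fun_prop)
    (fun t ht h => hCX' t.1 ht.1 (h ▸ ht.2))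
  let U : Set (Γ → B) := {x | ∃ x' ∈ X'.carrier, ∀ i ∈ E₁, x i = x' i}
  have hUC : ∀ x ∈ U, x ∉ C := by
    rintro x ⟨x', hx', h⟩ hx
    obtain ⟨i, hi, hne⟩ := hE₁ (x, x') ⟨hx, hx'⟩
    exact hne (h i hi)
  let _ : TopologicalSpace (Option B) := ⊥
  have : DiscreteTopology (Option B) := ⟨rfl⟩
  let g : (Γ → B) → A × Option B := fun x => (φ x, if x ∈ U then none else some (x 0))
  have hg : DependsOnWindow (insert 0 (E₀ ∪ E₁)) g := by
    intro x y h
    have h0 : x 0 = y 0 := h 0 (by simp)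
    have h1 : φ x = φ y := hφ x y fun i hi => h i (by simp [hi])
    have h2 : x ∈ U ↔ y ∈ U := by
      refine exists_congr fun x' => and_congr_right fun _ => forall₂_congr fun i hi => ?_
      rw [h i (by simp [hi])]
    simp only [g, h0, h1, h2]
  have hz := continuous_blockMap hg
  have hzs : ∀ x v, blockMap g x v =
      (blockMap φ x v, if shift v x ∈ U then none else some (x v)) := by
    intro x v
    simp [blockMap, g]
  let ε : (Γ → A) → Γ → A × Option B := fun y v => (y v, none)
  have hε : Continuous ε := by
    refine continuous_pi fun v => ?_
    exact (continuous_apply v).prodMk continuous_const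
  let Z : Subshift (A × Option B) Γ :=
    { carrier := blockMap g '' X.carrier ∪ ε '' Y.carrier
      isClosed := ((X.isClosed.isCompact.image hz).union
        (Y.isClosed.isCompact.image hε)).isClosed
      mapsTo := by
        rintro w _ (⟨x, hx, rfl⟩ | ⟨y, hy, rfl⟩)
        · exact Or.inl ⟨shift w x, X.mapsTo w hx, blockMap_shift g w x⟩
        · exact Or.inr ⟨shift w y, Y.mapsTo w hy, rfl⟩ }
  have hZ : GFree 𝒢 (A × Option B) Z := by
    rintro _ (⟨x, hx, rfl⟩ | ⟨y, hy, rfl⟩) Γ₀ hΓ₀ hle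
    · by_cases hU : ∃ v, shift v x ∈ U
      · obtain ⟨v, hv⟩ := hU
        refine hUC _ hv (Set.mem_biUnion hΓ₀ fun w hw => mem_stab.mpr fun u => ?_)
        have := mem_stab.mp (hle hw) (v + u)
        rw [hzs, hzs, Prod.mk.injEq] at this
        rw [blockMap_shift, shift_apply, shift_apply, ← this.1, add_left_comm]
      · push Not at hU
        obtain ⟨y, hy, hxy⟩ := hdom x hx
        refine hY.1 y hy Γ₀ hΓ₀ (le_trans (fun w hw => mem_stab.mpr fun u => ?_) hxy)
        have := mem_stab.mp (hle hw) u
        rw [hzs, hzs, Prod.mk.injEq, if_neg (hU _), if_neg (hU _)] at this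
        exact Option.some.inj this.2
    · refine hY.1 y hy Γ₀ hΓ₀ fun w hw => mem_stab.mpr fun u => ?_
      exact (Prod.mk.inj (mem_stab.mp (hle hw) u)).1
  let e : SubshiftMap Y Z := SubshiftMap.ofMapsTo ε hε (fun _ _ => rfl)
    fun y hy => Or.inr ⟨y, hy, rfl⟩
  have he : e.IsEmbedding := by
    intro y y' h
    refine Subtype.ext (funext fun v => ?_)
    exact (Prod.mk.inj (congrFun (congrArg Subtype.val h) v)).1
  obtain ⟨hsub, r, hr⟩ := hY.2 (A × Option B) Z hZ e he
  obtain ⟨q, hq⟩ := e.exists_leftInverse he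
  let ζ : SubshiftMap X Z := SubshiftMap.ofMapsTo (blockMap g) hz (blockMap_shift g)
    fun x hx => Or.inl ⟨x, hx, rfl⟩
  refine ⟨q.comp (r.comp ζ), fun x hx => he (Subtype.ext ?_)⟩
  -- Every translate of a point of `X'` lies in `U`, so its second layer is constantly `none`.
  have hζ : blockMap g x = ε (p'.toFun ⟨x, hx⟩) := by
    funext v
    have : shift v x ∈ U := ⟨shift v x, X'.mapsTo v hx, fun _ _ => rfl⟩
    rw [hzs, if_pos this, hΦ ⟨x, hx⟩]
  have hmem : blockMap g x ∈ e.range.carrier := ⟨p'.toFun ⟨x, hx⟩, hζ.symm⟩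
  refine (hq _).trans ((hr (blockMap g x) hmem).trans hζ)

end AbsoluteRetract

/-! ### Counting aperiodic colorings -/

section Coloring

theorem finite_setOf_eq_zero_off {ι : Type*} {m : ℕ} [NeZero m] (S : Finset ι) :
    {f : ι → Fin m | ∀ x ∉ S, f x = 0}.Finite := by
  refine Set.Finite.of_injOn (f := fun f (x : S) => f x) (Set.mapsTo_univ _ _) ?_ Set.finite_univ
  intro f hf g hg h
  funext x
  by_cases hx : x ∈ S
  · exact congrFun h ⟨x, hx⟩
  · rw [hf x hx, hg x hx]

variable {Q : Type*} [AddCommGroup Q]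

/-- On every translate of the window `K i` which lies in `S` together with its `d i`-translate,
the coloring `f` is not `d i`-periodic. -/
def IsAperiodicOn {C : Type*} (J : Finset ℕ) (K : ℕ → Finset Q) (d : ℕ → Q) (S : Finset Q)
    (f : Q → C) : Prop :=
  ∀ i ∈ J, ∀ u, (∀ k ∈ K i, u + k ∈ S ∧ u + k + d i ∈ S) → ∃ k ∈ K i, f (u + k) ≠ f (u + k + d i)

/-- The aperiodic colorings of `S`, extended by `0`. -/
def aperiodicColorings (m : ℕ) [NeZero m] (J : Finset ℕ) (K : ℕ → Finset Q) (d : ℕ → Q)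
    (S : Finset Q) : Set (Q → Fin m) :=
  {f | (∀ x ∉ S, f x = 0) ∧ IsAperiodicOn J K d S f}

variable {m : ℕ} [NeZero m] {J : Finset ℕ} {K : ℕ → Finset Q} {d : ℕ → Q}

theorem IsAperiodicOn.congr {C : Type*} {S T : Finset Q} {f g : Q → C}
    (hf : IsAperiodicOn J K d S f) (hT : T ⊆ S) (hfg : ∀ x ∈ T, f x = g x) :
    IsAperiodicOn J K d T g := by
  intro i hi u hu
  obtain ⟨k, hk, hne⟩ := hf i hi u fun k hk => ⟨hT (hu k hk).1, hT (hu k hk).2⟩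
  exact ⟨k, hk, by rwa [← hfg _ (hu k hk).1, ← hfg _ (hu k hk).2]⟩

theorem finite_aperiodicColorings (S : Finset Q) : (aperiodicColorings m J K d S).Finite :=
  (finite_setOf_eq_zero_off S).subset fun _ hf => hf.1

/-- Colorings of `insert s S` that are determined by their restriction outside `P`, which is
aperiodic, are at most as many as the aperiodic colorings of `S \ P`. -/
theorem ncard_le_of_determined [DecidableEq Q] {S P : Finset Q} {s : Q} (hs : s ∈ P)
    {τ : Q → Q} (hτ : ∀ x ∈ P, τ x ∉ P) :
    {f : Q → Fin m | (∀ x ∉ insert s S, f x = 0) ∧ IsAperiodicOn J K d S f ∧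
      ∀ x ∈ P, f x = f (τ x)}.ncard ≤ (aperiodicColorings m J K d (S \ P)).ncard := by
  refine Set.ncard_le_ncard_of_injOn (fun f x => if x ∈ P then 0 else f x) ?_ ?_
    (finite_aperiodicColorings _)
  · rintro f ⟨hf0, hf, -⟩
    refine ⟨fun x hx => ?_, hf.congr Finset.sdiff_subset fun x hx => ?_⟩
    · by_cases hxP : x ∈ P
      · simp [hxP]
      · simp only [hxP, if_false]
        refine hf0 x fun h => ?_
        obtain rfl | h := Finset.mem_insert.mp h
        · exact hxP hs
        · exact hx (Finset.mem_sdiff.mpr ⟨h, hxP⟩)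
    · simp [(Finset.mem_sdiff.mp hx).2]
  · rintro f ⟨-, -, hf⟩ g ⟨-, -, hg⟩ h
    have h' : ∀ x ∉ P, f x = g x := fun x hx => by simpa [hx] using congrFun h x
    funext x
    by_cases hx : x ∈ P
    · rw [hf x hx, hg x hx, h' _ (hτ x hx)]
    · exact h' x hx

theorem sum_weights (n : ℕ) :
    ∑ i ∈ Finset.range n, 2 * ((i : ℝ) + 1) / 2 ^ i = 8 - 4 * (n + 2) / 2 ^ n := by
  induction n with
  | zero => norm_num
  | succ n ih =>
    rw [Finset.sum_range_succ, ih]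
    push_cast
    field_simp
    ring

theorem sum_weights_le (J : Finset ℕ) : ∑ i ∈ J, 2 * ((i : ℝ) + 1) / 2 ^ i ≤ 8 := by
  obtain ⟨n, hn⟩ := J.exists_nat_subset_range
  calc _ ≤ ∑ i ∈ Finset.range n, 2 * ((i : ℝ) + 1) / 2 ^ i :=
        Finset.sum_le_sum_of_subset_of_nonneg hn fun _ _ _ => by positivity
    _ ≤ 8 := by
        rw [sum_weights]
        have : (0 : ℝ) ≤ 4 * (n + 2) / 2 ^ n := by positivity
        linarith

/-- Every color of a new point extends an aperiodic coloring, unless a translate of a window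
through the new point becomes periodic. -/
theorem ncard_mul_le [DecidableEq Q] (hdisj : ∀ i ∈ J, ∀ k ∈ K i, ∀ k' ∈ K i, k + d i ≠ k')
    {S : Finset Q} {s : Q} (hs : s ∉ S) :
    (aperiodicColorings m J K d S).ncard * m ≤ (aperiodicColorings m J K d (insert s S)).ncard +
      ∑ i ∈ J, ∑ k ∈ K i with (K i).image (s - k + ·) ⊆ insert s S,
        2 * (aperiodicColorings m J K d (S \ (K i).image (s - k + ·))).ncard := by
  let P : ℕ → Q → Finset Q := fun i k => (K i).image (s - k + ·)
  let D : ℕ → Finset Q := fun i => (K i).filter fun k => P i k ⊆ insert s S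
  let Bad : (Q → Q) → Finset Q → Set (Q → Fin m) := fun τ P =>
    {f | (∀ x ∉ insert s S, f x = 0) ∧ IsAperiodicOn J K d S f ∧ ∀ x ∈ P, f x = f (τ x)}
  have hfin : ∀ τ P, (Bad τ P).Finite := fun τ P =>
    (finite_setOf_eq_zero_off (insert s S)).subset fun _ hf => hf.1
  -- The factor 2 arises because the new point may lie in the periodic window or in its `d
  -- i`-translate. Either way, the copy containing `s` is determined by the other copy, which is
  -- disjoint from it.
  have hbad : ∀ i ∈ J, ∀ k ∈ K i, (Bad (· + d i) (P i k) ∪ Bad (· - d i) (P i k)).ncard ≤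
      2 * (aperiodicColorings m J K d (S \ P i k)).ncard := by
    intro i hi k hk
    have hsP : s ∈ P i k := Finset.mem_image.mpr ⟨k, hk, by abel⟩
    rw [two_mul]
    refine (Set.ncard_union_le _ _).trans (add_le_add ?_ ?_)
    · refine ncard_le_of_determined hsP fun x hx hx' => ?_
      obtain ⟨k₁, hk₁, rfl⟩ := Finset.mem_image.mp hx
      obtain ⟨k₂, hk₂, h⟩ := Finset.mem_image.mp hx'
      refine hdisj i hi k₁ hk₁ k₂ hk₂ (add_left_cancel (a := s - k) ?_)
      rw [h, add_assoc]
    · refine ncard_le_of_determined hsP fun x hx hx' => ?_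
      obtain ⟨k₁, hk₁, rfl⟩ := Finset.mem_image.mp hx
      obtain ⟨k₂, hk₂, h⟩ := Finset.mem_image.mp hx'
      refine hdisj i hi k₂ hk₂ k₁ hk₁ (add_left_cancel (a := s - k) ?_)
      rw [← add_assoc, h, sub_add_cancel]
  let T : Set (Q → Fin m) := ⋃ i ∈ J, ⋃ k ∈ D i, Bad (· + d i) (P i k) ∪ Bad (· - d i) (P i k)
  have hTfin : T.Finite := J.finite_toSet.biUnion fun i _ =>
    (D i).finite_toSet.biUnion fun k _ => (hfin _ _).union (hfin _ _)
  have hT : T.ncard ≤ ∑ i ∈ J, ∑ k ∈ D i, 2 * (aperiodicColorings m J K d (S \ P i k)).ncard :=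
    (Finset.set_ncard_biUnion_le _ _).trans <| Finset.sum_le_sum fun i hi =>
      (Finset.set_ncard_biUnion_le _ _).trans <| Finset.sum_le_sum fun k hk =>
        hbad i hi k (Finset.mem_filter.mp hk).1
  refine le_trans ?_ ((Set.ncard_union_le _ T).trans (Nat.add_le_add_left hT _))
  have hcount : (aperiodicColorings m J K d S ×ˢ (Set.univ : Set (Fin m))).ncard =
      (aperiodicColorings m J K d S).ncard * m := by
    rw [Set.ncard_prod, Set.ncard_univ, Nat.card_fin]
  rw [← hcount]
  refine Set.ncard_le_ncard_of_injOn (fun p => Function.update p.1 s p.2) ?_ ?_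
    ((finite_aperiodicColorings _).union hTfin)
  · rintro ⟨f, a⟩ ⟨⟨hf0, hf⟩, -⟩
    set g := Function.update f s a with hg
    have hg0 : ∀ x ∉ insert s S, g x = 0 := by
      intro x hx
      rw [Finset.mem_insert, not_or] at hx
      rw [hg, Function.update_of_ne hx.1]
      exact hf0 x hx.2
    have hgS : IsAperiodicOn J K d S g := hf.congr subset_rfl fun x hx => by
      rw [hg, Function.update_of_ne (ne_of_mem_of_not_mem hx hs)]
    by_cases hgood : IsAperiodicOn J K d (insert s S) g
    · exact Or.inl ⟨hg0, hgood⟩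
    · right
      unfold IsAperiodicOn at hgood
      push Not at hgood
      obtain ⟨i, hi, u, hu, hper⟩ := hgood
      have hmem : ∃ k ∈ K i, u + k = s ∨ u + k + d i = s := by
        by_contra! hne
        obtain ⟨k, hk, hk'⟩ := hgS i hi u fun k hk =>
          ⟨Finset.mem_of_mem_insert_of_ne (hu k hk).1 (hne k hk).1,
            Finset.mem_of_mem_insert_of_ne (hu k hk).2 (hne k hk).2⟩
        exact hk' (hper k hk)
      obtain ⟨k, hk, h | h⟩ := hmem
      · have hsk : s - k = u := by rw [← h]; abel
        have hPk : P i k = (K i).image (u + ·) := by simp only [P, hsk]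
        refine Set.mem_biUnion hi (Set.mem_biUnion (x := k) ?_ (Or.inl ⟨hg0, hgS, ?_⟩))
        · refine Finset.mem_filter.mpr ⟨hk, ?_⟩
          rw [hPk, Finset.image_subset_iff]
          exact fun x hx => (hu x hx).1
        · rw [hPk]
          intro x hx
          obtain ⟨k', hk', rfl⟩ := Finset.mem_image.mp hx
          exact hper k' hk'
      · have hsk : s - k = u + d i := by rw [← h]; abel
        have hPk : P i k = (K i).image (u + d i + ·) := by simp only [P, hsk]
        refine Set.mem_biUnion hi (Set.mem_biUnion (x := k) ?_ (Or.inr ⟨hg0, hgS, ?_⟩))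
        · refine Finset.mem_filter.mpr ⟨hk, ?_⟩
          rw [hPk, Finset.image_subset_iff]
          intro x hx
          rw [add_right_comm]
          exact (hu x hx).2
        · rw [hPk]
          intro x hx
          obtain ⟨k', hk', rfl⟩ := Finset.mem_image.mp hx
          rw [add_right_comm]
          simp only [add_sub_cancel_right]
          exact (hper k' hk').symm
  · rintro ⟨f, a⟩ ⟨⟨hf0, -⟩, -⟩ ⟨f', a'⟩ ⟨⟨hf0', -⟩, -⟩ h
    simp only at h
    refine Prod.ext (funext fun x => ?_) (by simpa using congrFun h s)
    by_cases hx : x = s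
    · subst hx
      exact (hf0 x hs).trans (hf0' x hs).symm
    · simpa [hx] using congrFun h x

/-- By strong induction, deleting `i` points of `S` divides the count by at least `2 ^ i`. With 10
colors the bad extensions therefore number at most `∑ 2 (i + 1) / 2 ^ i ≤ 8` times the count for
`S`, which leaves a factor 2. -/
theorem two_mul_ncard_le (hcard : ∀ i ∈ J, (K i).card = i + 1)
    (hdisj : ∀ i ∈ J, ∀ k ∈ K i, ∀ k' ∈ K i, k + d i ≠ k') [DecidableEq Q] (S : Finset Q) :
    ∀ s ∉ S, 2 * (aperiodicColorings 10 J K d S).ncard ≤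
      (aperiodicColorings 10 J K d (insert s S)).ncard := by
  induction S using Finset.strongInduction with
  | H S ih =>
  intro s hs
  have hpow : ∀ R : Finset Q, R ⊆ S → 2 ^ R.card * (aperiodicColorings 10 J K d (S \ R)).ncard ≤
      (aperiodicColorings 10 J K d S).ncard := by
    intro R
    induction R using Finset.induction_on with
    | empty => simp
    | insert r R hr ihR =>
      intro hRS
      have hrS := hRS (Finset.mem_insert_self r R)
      have h1 := ih (S \ insert r R) (Finset.sdiff_ssubset hRS ⟨r, Finset.mem_insert_self r R⟩) r
        (by simp)
      have h2 : insert r (S \ insert r R) = S \ R := by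
        ext x
        simp only [Finset.mem_insert, Finset.mem_sdiff]
        by_cases hx : x = r
        · subst hx; simp [hrS, hr]
        · simp [hx]
      rw [h2] at h1
      rw [Finset.card_insert_of_notMem hr, pow_succ, mul_assoc]
      exact (Nat.mul_le_mul_left _ h1).trans
        (ihR ((Finset.subset_insert r R).trans hRS))
  set N := (aperiodicColorings 10 J K d S).ncard
  have hterm : ∀ i ∈ J, ∀ k ∈ K i, (K i).image (s - k + ·) ⊆ insert s S →
      ((aperiodicColorings 10 J K d (S \ (K i).image (s - k + ·))).ncard : ℝ) ≤ N / 2 ^ i := by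
    intro i hi k hk hP
    set P := (K i).image (s - k + ·) with hPdef
    have hsP : s ∈ P := Finset.mem_image.mpr ⟨k, hk, by abel⟩
    have hPcard : P.card = i + 1 := by
      rw [hPdef, Finset.card_image_of_injective _ (add_right_injective _), hcard i hi]
    -- Since `s` is not in `S`, only `i` of the `i + 1` points of the window are removed from `S`.
    have h1 := hpow (P.erase s) fun x hx => Finset.mem_of_mem_insert_of_ne
      (hP (Finset.mem_of_mem_erase hx)) (Finset.ne_of_mem_erase hx)
    rw [Finset.card_erase_of_mem hsP, hPcard, Nat.add_sub_cancel,
      show S \ P.erase s = S \ P by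
        ext x
        simp only [Finset.mem_sdiff, Finset.mem_erase]
        exact and_congr_right fun hx => by simp [ne_of_mem_of_not_mem hx hs]] at h1
    rw [le_div_iff₀ (by positivity), mul_comm]
    exact_mod_cast h1
  have hsum : ∑ i ∈ J, ∑ k ∈ K i with (K i).image (s - k + ·) ⊆ insert s S,
      (2 * ((aperiodicColorings 10 J K d (S \ (K i).image (s - k + ·))).ncard : ℝ)) ≤ 8 * N := by
    calc _ ≤ ∑ i ∈ J, (2 * ((i : ℝ) + 1) / 2 ^ i) * N := by
          refine Finset.sum_le_sum fun i hi => ?_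
          refine (Finset.sum_le_card_nsmul _ _ (2 * ((N : ℝ) / 2 ^ i)) fun k hk => ?_).trans ?_
          · rw [Finset.mem_filter] at hk
            exact mul_le_mul_of_nonneg_left (hterm i hi k hk.1 hk.2) two_pos.le
          · rw [nsmul_eq_mul]
            have : (((K i).filter fun k => (K i).image (s - k + ·) ⊆ insert s S).card : ℝ) ≤
                i + 1 := by
              exact_mod_cast (Finset.card_filter_le _ _).trans (hcard i hi).le
            calc _ ≤ ((i : ℝ) + 1) * (2 * ((N : ℝ) / 2 ^ i)) :=
                  mul_le_mul_of_nonneg_right this (by positivity)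
              _ = _ := by ring
      _ = (∑ i ∈ J, 2 * ((i : ℝ) + 1) / 2 ^ i) * N := (Finset.sum_mul _ _ _).symm
      _ ≤ 8 * N := mul_le_mul_of_nonneg_right (sum_weights_le J) (Nat.cast_nonneg _)
  have hmain := ncard_mul_le (m := 10) hdisj hs
  have hmain' : (N : ℝ) * 10 ≤ (aperiodicColorings 10 J K d (insert s S)).ncard +
      ∑ i ∈ J, ∑ k ∈ K i with (K i).image (s - k + ·) ⊆ insert s S,
        (2 * ((aperiodicColorings 10 J K d (S \ (K i).image (s - k + ·))).ncard : ℝ)) := by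
    exact_mod_cast hmain
  have : (2 * N : ℝ) ≤ (aperiodicColorings 10 J K d (insert s S)).ncard := by linarith
  exact_mod_cast this

theorem exists_isAperiodicOn (hcard : ∀ i ∈ J, (K i).card = i + 1)
    (hdisj : ∀ i ∈ J, ∀ k ∈ K i, ∀ k' ∈ K i, k + d i ≠ k') (S : Finset Q) :
    ∃ f : Q → Fin 10, IsAperiodicOn J K d S f := by
  classical
  have hpos : 0 < (aperiodicColorings 10 J K d S).ncard := by
    induction S using Finset.induction_on with
    | empty =>
      refine (Set.ncard_pos (finite_aperiodicColorings _)).mpr ⟨0, fun _ _ => rfl, ?_⟩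
      intro i hi u hu
      obtain ⟨k, hk⟩ := Finset.card_pos.mp ((Nat.succ_pos i).trans_eq (hcard i hi).symm)
      exact absurd (hu k hk).1 (Finset.notMem_empty _)
    | insert s S hs ih =>
      have := two_mul_ncard_le hcard hdisj S s hs
      omega
  obtain ⟨f, hf⟩ := (Set.ncard_pos (finite_aperiodicColorings _)).mp hpos
  exact ⟨f, hf.2⟩

/-- In an infinite group, there are arbitrarily large finite sets that are disjoint from their
translate by a given nonzero element. -/
theorem exists_card_eq_disjoint_translate [Infinite Q] {q : Q} (hq : q ≠ 0) (n : ℕ) :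
    ∃ K : Finset Q, K.card = n ∧ ∀ k ∈ K, ∀ k' ∈ K, k + q ≠ k' := by
  classical
  induction n with
  | zero => exact ⟨∅, rfl, by simp⟩
  | succ n ih =>
    obtain ⟨K, hK, h⟩ := ih
    obtain ⟨x, hx⟩ := Infinite.exists_notMem_finset (K ∪ K.image (· + q) ∪ K.image (· - q))
    simp only [Finset.mem_union, Finset.mem_image, not_or, not_exists, not_and] at hx
    refine ⟨insert x K, by rw [Finset.card_insert_of_notMem hx.1.1, hK], fun k hk k' hk' he => ?_⟩
    rw [Finset.mem_insert] at hk hk'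
    obtain rfl | hk := hk <;> obtain hk' | hk' := hk'
    · exact hq (by simpa [hk'] using he)
    · exact hx.2 k' hk' (by rw [← he]; abel)
    · exact hx.1.2 k hk (he.trans hk')
    · exact h k hk k' hk' he

end Coloring

/-! ### Periodic colorings and limits of subgroups -/

section PeriodicPatterns

variable {Γ : Type v} [AddCommGroup Γ]

/-- The windows are lifted from the infinite quotient `Γ ⧸ H`, hence do not depend on `N`. The set
`E` records the differences that decide whether a window stays injective and disjoint from its
translate modulo `N`; the counting argument then applies in `Γ ⧸ N`. -/
theorem exists_periodic_coloring_of_infinite (H : AddSubgroup Γ) [Infinite (Γ ⧸ H)] (v : ℕ → Γ) :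
    ∃ K : ℕ → Finset Γ, ∀ n, ∃ E : Finset Γ, ∀ N : AddSubgroup Γ, (∀ e ∈ E, e ∈ N ↔ e ∈ H) →
      ∀ W : Finset Γ, ∃ c : Γ → Fin 10, (∀ w, ∀ h ∈ N, c (w + h) = c w) ∧
        ∀ i ≤ n, v i ∉ H → ∀ u, (∀ k ∈ K i, u + k ∈ W ∧ u + k + v i ∈ W) →
          ∃ k ∈ K i, c (u + k) ≠ c (u + k + v i) := by
  classical
  have hK : ∀ i, ∃ K : Finset Γ, v i ∉ H → K.card = i + 1 ∧
      (∀ k ∈ K, ∀ k' ∈ K, k - k' ∈ H → k = k') ∧ ∀ k ∈ K, ∀ k' ∈ K, k + v i - k' ∉ H := by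
    intro i
    by_cases hi : v i ∈ H
    · exact ⟨∅, fun h => absurd hi h⟩
    obtain ⟨K, hK, hdisj⟩ := exists_card_eq_disjoint_translate
      (q := (QuotientAddGroup.mk (v i) : Γ ⧸ H))
      (fun h => hi ((QuotientAddGroup.eq_zero_iff _).mp h)) (i + 1)
    have hmem : ∀ k ∈ K.image Quotient.out, (k : Γ ⧸ H) ∈ K := by
      intro k hk
      obtain ⟨q, hq, rfl⟩ := Finset.mem_image.mp hk
      rwa [QuotientAddGroup.out_eq']
    refine ⟨K.image Quotient.out, fun _ => ⟨?_, ?_, ?_⟩⟩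
    · rw [Finset.card_image_of_injective _ Quotient.out_injective, hK]
    · intro k hk k' hk' h
      obtain ⟨q, hq, rfl⟩ := Finset.mem_image.mp hk
      obtain ⟨q', hq', rfl⟩ := Finset.mem_image.mp hk'
      have := (QuotientAddGroup.eq_zero_iff _).mpr h
      rw [QuotientAddGroup.mk_sub, QuotientAddGroup.out_eq', QuotientAddGroup.out_eq',
        sub_eq_zero] at this
      rw [this]
    · intro k hk k' hk' h
      have := (QuotientAddGroup.eq_zero_iff _).mpr h
      rw [QuotientAddGroup.mk_sub, QuotientAddGroup.mk_add, sub_eq_zero] at this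
      exact hdisj _ (hmem k hk) _ (hmem k' hk') this
  choose K hK using hK
  refine ⟨K, fun n => ⟨(Finset.range (n + 1)).biUnion fun i =>
    Finset.image₂ (fun k k' => k - k') (K i) (K i) ∪
      Finset.image₂ (fun k k' => k + v i - k') (K i) (K i), fun N hN W => ?_⟩⟩
  have hN₁ : ∀ i ≤ n, ∀ k ∈ K i, ∀ k' ∈ K i, k - k' ∈ N → k - k' ∈ H := fun i hi k hk k' hk' =>
    (hN _ (Finset.mem_biUnion.mpr ⟨i, Finset.mem_range_succ_iff.mpr hi,
      Finset.mem_union_left _ (Finset.mem_image₂_of_mem hk hk')⟩)).mp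
  have hN₂ : ∀ i ≤ n, ∀ k ∈ K i, ∀ k' ∈ K i, k + v i - k' ∈ N → k + v i - k' ∈ H :=
    fun i hi k hk k' hk' => (hN _ (Finset.mem_biUnion.mpr ⟨i, Finset.mem_range_succ_iff.mpr hi,
      Finset.mem_union_right _ (Finset.mem_image₂_of_mem hk hk')⟩)).mp
  let π : Γ → Γ ⧸ N := QuotientAddGroup.mk
  obtain ⟨f, hf⟩ := exists_isAperiodicOn (Q := Γ ⧸ N)
    (J := (Finset.range (n + 1)).filter fun i => v i ∉ H) (K := fun i => (K i).image π)
    (d := fun i => π (v i))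
    (fun i hi => by
      obtain ⟨hi, hvi⟩ := Finset.mem_filter.mp hi
      rw [Finset.card_image_of_injOn, (hK i hvi).1]
      intro k hk k' hk' h
      refine (hK i hvi).2.1 k hk k' hk' (hN₁ i (Finset.mem_range_succ_iff.mp hi) k hk k' hk' ?_)
      rw [← QuotientAddGroup.eq_zero_iff, QuotientAddGroup.mk_sub]
      exact sub_eq_zero.mpr h)
    (fun i hi q hq q' hq' h => by
      obtain ⟨hi, hvi⟩ := Finset.mem_filter.mp hi
      obtain ⟨k, hk, rfl⟩ := Finset.mem_image.mp hq
      obtain ⟨k', hk', rfl⟩ := Finset.mem_image.mp hq'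
      refine (hK i hvi).2.2 k hk k' hk' (hN₂ i (Finset.mem_range_succ_iff.mp hi) k hk k' hk' ?_)
      rw [← QuotientAddGroup.eq_zero_iff, QuotientAddGroup.mk_sub]
      exact sub_eq_zero.mpr h) (W.image π)
  refine ⟨fun w => f (π w), fun w h hh => ?_, fun i hi hvi u hu => ?_⟩
  · exact congrArg f (QuotientAddGroup.mk_add_of_mem w hh)
  · obtain ⟨q, hq, hne⟩ := hf i (Finset.mem_filter.mpr ⟨Finset.mem_range_succ_iff.mpr hi, hvi⟩)
      (π u) (fun q hq => by
        obtain ⟨k, hk, rfl⟩ := Finset.mem_image.mp hq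
        exact ⟨Finset.mem_image_of_mem π (hu k hk).1, Finset.mem_image_of_mem π (hu k hk).2⟩)
    obtain ⟨k, hk, rfl⟩ := Finset.mem_image.mp hq
    exact ⟨k, hk, hne⟩

/-- For a subgroup `H` of finite index and a finitely generated subgroup `L`, the intersection of
`L` with any subgroup close enough to `H` is contained in `H`. -/
theorem exists_finset_inf_le_of_finite (H : AddSubgroup Γ) [Finite (Γ ⧸ H)] (F : Finset Γ) :
    ∃ E : Finset Γ, ∀ N : AddSubgroup Γ, (∀ e ∈ E, e ∈ N ↔ e ∈ H) →
      ∀ x ∈ AddSubgroup.closure (F : Set Γ), x ∈ N → x ∈ H := by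
  classical
  have := Fintype.ofFinite (Γ ⧸ H)
  let L : Submodule ℤ Γ := Submodule.span ℤ F
  have hL : ∀ x, x ∈ AddSubgroup.closure (F : Set Γ) ↔ x ∈ L := fun x => by
    rw [← Submodule.mem_toAddSubgroup, Submodule.span_int_eq_addSubgroupClosure]
  have hnoeth : IsNoetherian ℤ L := isNoetherian_of_fg_of_noetherian L ⟨F, rfl⟩
  obtain ⟨G, hG⟩ := isNoetherian_submodule.mp hnoeth (L ⊓ AddSubgroup.toIntSubmodule H)
    inf_le_left
  -- `G` generates `L ⊓ H`, and `R` represents the cosets of `H` that meet `L`, with 0 as a harmless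
  -- default. Agreement on `G` puts `L ⊓ H` inside `N`; agreement on `R` then excludes the
  -- nontrivial cosets.
  let R : Finset Γ := Finset.univ.image fun q : Γ ⧸ H =>
    if h : ∃ l ∈ L, (l : Γ ⧸ H) = q then h.choose else 0
  refine ⟨G ∪ R, fun N hN x hxL hxN => ?_⟩
  have hGN : L ⊓ AddSubgroup.toIntSubmodule H ≤ AddSubgroup.toIntSubmodule N := by
    rw [← hG, Submodule.span_le]
    intro g hg
    have hgH : g ∈ L ⊓ AddSubgroup.toIntSubmodule H := hG ▸ Submodule.subset_span hg
    exact (hN g (Finset.mem_union_left _ hg)).mpr hgH.2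
  have hx : ∃ l ∈ L, (l : Γ ⧸ H) = x := ⟨x, (hL x).mp hxL, rfl⟩
  have hrR : hx.choose ∈ R := Finset.mem_image.mpr ⟨x, Finset.mem_univ _, dif_pos hx⟩
  obtain ⟨hrL, hrx⟩ := hx.choose_spec
  set r := hx.choose
  have hxr : x - r ∈ H := by
    rw [← QuotientAddGroup.eq_zero_iff, QuotientAddGroup.mk_sub, hrx, sub_self]
  have hxrN : x - r ∈ N := hGN ⟨L.sub_mem ((hL x).mp hxL) hrL, hxr⟩
  have hrH : r ∈ H := (hN r (Finset.mem_union_right _ hrR)).mp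
    (by simpa using N.sub_mem hxN hxrN)
  simpa using H.add_mem hxr hrH

/-- Let `L` be generated by the `v i` with `i ≤ n`, and write `w` as a representative modulo `L ⊔ N`
plus an element of `L` plus one of `N`. The `L`-part is unique modulo `L ⊓ N ≤ H`, so its class
modulo `H` is an `N`-periodic color, and adding `v i` shifts it by the class of `v i`. -/
theorem exists_periodic_coloring_of_finite (H : AddSubgroup Γ) [Finite (Γ ⧸ H)] (v : ℕ → Γ)
    (n : ℕ) :
    ∃ E : Finset Γ, ∀ N : AddSubgroup Γ, (∀ e ∈ E, e ∈ N ↔ e ∈ H) →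
      ∃ c : Γ → Γ ⧸ H, (∀ w, ∀ h ∈ N, c (w + h) = c w) ∧
        ∀ i ≤ n, v i ∉ H → ∀ u, c u ≠ c (u + v i) := by
  classical
  let F := (Finset.range (n + 1)).image v
  obtain ⟨E, hE⟩ := exists_finset_inf_le_of_finite H F
  refine ⟨E, fun N hN => ?_⟩
  let L := AddSubgroup.closure (F : Set Γ)
  let s : Γ → Γ := fun w => (w : Γ ⧸ (L ⊔ N)).out
  have hs : ∀ w x, x ∈ L ⊔ N → s (w + x) = s w := fun w x hx =>
    congrArg Quotient.out (QuotientAddGroup.mk_add_of_mem w hx)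
  have hdec : ∀ w, ∃ l ∈ L, ∃ h ∈ N, l + h = w - s w := by
    intro w
    refine AddSubgroup.mem_sup.mp ?_
    rw [← QuotientAddGroup.eq_zero_iff, QuotientAddGroup.mk_sub, QuotientAddGroup.out_eq',
      sub_self]
  choose l hl h hh hlh using hdec
  have key : ∀ w x, x ∈ L ⊔ N → ∀ a ∈ L, x - a ∈ N → l (w + x) - l w - a ∈ H := by
    intro w x hx a ha hxa
    refine hE N hN _ (L.sub_mem (L.sub_mem (hl _) (hl _)) ha) ?_
    have h1 := hlh (w + x)
    rw [hs w x hx] at h1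
    have : l (w + x) - l w - a = (x - a) - (h (w + x) - h w) := by
      rw [eq_sub_of_add_eq h1, eq_sub_of_add_eq (hlh w)]
      abel
    rw [this]
    exact N.sub_mem hxa (N.sub_mem (hh _) (hh _))
  refine ⟨fun w => (l w : Γ ⧸ H), fun w x hx => ?_, fun i hi hvi u he => hvi ?_⟩
  · have := key w x (AddSubgroup.mem_sup_right hx) 0 L.zero_mem (by simpa using hx)
    rw [sub_zero, ← QuotientAddGroup.eq_zero_iff, QuotientAddGroup.mk_sub] at this
    exact sub_eq_zero.mp this
  · have hvL : v i ∈ L := AddSubgroup.subset_closure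
      (Finset.mem_coe.mpr (Finset.mem_image_of_mem v (Finset.mem_range_succ_iff.mpr hi)))
    have := key u (v i) (AddSubgroup.mem_sup_left hvL) (v i) hvL (by simp)
    rw [← QuotientAddGroup.eq_zero_iff, QuotientAddGroup.mk_sub, QuotientAddGroup.mk_sub,
      sub_eq_zero.mpr he.symm, zero_sub, neg_eq_zero] at this
    exact (QuotientAddGroup.eq_zero_iff _).mp this

/-- Subgroups `N` approximating `H` admit `N`-periodic colorings that detect, uniformly in `N`,
the elements outside `H`. -/
theorem exists_periodic_coloring (H : AddSubgroup Γ) (v : ℕ → Γ) :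
    ∃ (m : ℕ) (K : ℕ → Finset Γ), ∀ n, ∃ E : Finset Γ, ∀ N : AddSubgroup Γ,
      (∀ e ∈ E, e ∈ N ↔ e ∈ H) →
      ∀ W : Finset Γ, ∃ c : Γ → Fin m, (∀ w, ∀ h ∈ N, c (w + h) = c w) ∧
        ∀ i ≤ n, v i ∉ H → ∀ u, (∀ k ∈ K i, u + k ∈ W ∧ u + k + v i ∈ W) →
          ∃ k ∈ K i, c (u + k) ≠ c (u + k + v i) := by
  obtain hfin | hinf := finite_or_infinite (Γ ⧸ H)
  · let φ := Finite.equivFin (Γ ⧸ H)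
    refine ⟨Nat.card (Γ ⧸ H), fun _ => {0}, fun n => ?_⟩
    obtain ⟨E, hE⟩ := exists_periodic_coloring_of_finite H v n
    refine ⟨E, fun N hN W => ?_⟩
    obtain ⟨c, hc, hne⟩ := hE N hN
    refine ⟨fun w => φ (c w), fun w h hh => congrArg φ (hc w h hh), fun i hi hvi u _ => ?_⟩
    refine ⟨0, Finset.mem_singleton_self 0, ?_⟩
    rw [add_zero]
    exact φ.injective.ne (hne i hi hvi u)
  · exact ⟨10, exists_periodic_coloring_of_infinite H v⟩

/-- Every finite set lies in a finite set which is, for each `i ≤ n`, a union of translates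
of `L i`. -/
theorem exists_finset_union_translates (L : ℕ → Finset Γ) (hL : ∀ i, 0 ∈ L i) (W₀ : Finset Γ)
    (n : ℕ) : ∃ W : Finset Γ, W₀ ⊆ W ∧
      ∀ i < n, ∀ w ∈ W, ∃ l ∈ L i, ∀ l' ∈ L i, w - l + l' ∈ W := by
  classical
  induction n with
  | zero => exact ⟨W₀, subset_rfl, by simp⟩
  | succ n ih =>
    obtain ⟨W, hW₀, hW⟩ := ih
    refine ⟨Finset.image₂ (· + ·) W (L n), fun w hw => ?_, fun i hi w hw => ?_⟩
    · exact Finset.mem_image₂.mpr ⟨w, hW₀ hw, 0, hL n, add_zero w⟩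
    · obtain ⟨a, ha, b, hb, rfl⟩ := Finset.mem_image₂.mp hw
      obtain hi | rfl := Nat.lt_succ_iff_lt_or_eq.mp hi
      · obtain ⟨l, hl, h⟩ := hW i hi a ha
        refine ⟨l, hl, fun l' hl' => Finset.mem_image₂.mpr ⟨_, h l' hl', b, hb, ?_⟩⟩
        abel
      · refine ⟨b, hb, fun l' hl' => Finset.mem_image₂.mpr ⟨a, ha, l', hl', ?_⟩⟩
        abel

variable {A : Type u} [Finite A] [TopologicalSpace A] [DiscreteTopology A]

/-- Finitely many pairs of positions witness that no point of `Y` is fixed by `N`. -/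
theorem exists_finset_not_le_stab {Y : Subshift A Γ} {N : AddSubgroup Γ}
    (hN : ∀ y ∈ Y.carrier, ¬ N ≤ stab y) :
    ∃ P : Finset (Γ × N), ∀ y ∈ Y.carrier, ∃ p ∈ P, y p.1 ≠ y (p.1 + p.2) := by
  refine exists_finset_separating Y.isClosed.isCompact (a := fun y (p : Γ × N) => y p.1)
    (b := fun y (p : Γ × N) => y (p.1 + p.2)) (fun p => continuous_apply _)
    (fun p => continuous_apply _)
    fun y hy h => hN y hy fun w hw => mem_stab.mpr fun u => ?_
  rw [add_comm]
  exact (congrFun h (u, ⟨w, hw⟩)).symm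

/-- The two conclusions pull in opposite directions: `c` is periodic enough to obstruct a block code
into `Y`, yet every `v i` outside `H` is refuted as a period near each point of `W`. The search
range `M i` does not depend on `n`, so the refutation survives in limits. -/
theorem exists_patterns {Y : Subshift A Γ} (v : ℕ → Γ) {H : AddSubgroup Γ}
    (hH : ∀ E : Finset Γ, ∃ N : AddSubgroup Γ, (∀ e ∈ E, e ∈ N ↔ e ∈ H) ∧
      ∀ y ∈ Y.carrier, ¬ N ≤ stab y) :
    ∃ (m : ℕ) (M : ℕ → Finset Γ), ∀ n, ∃ (W : Finset Γ) (c : Γ → Fin m),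
      (∀ y ∈ Y.carrier, ∃ u u', y u ≠ y u' ∧ ∀ i ≤ n,
        u + v i ∈ W ∧ u' + v i ∈ W ∧ c (u + v i) = c (u' + v i)) ∧
      ∀ i ≤ n, v i ∉ H → ∀ w ∈ W, ∃ t ∈ M i,
        w + t ∈ W ∧ w + t + v i ∈ W ∧ c (w + t) ≠ c (w + t + v i) := by
  classical
  obtain ⟨m, K, hK⟩ := exists_periodic_coloring H v
  -- `W` is made a union of translates of each `L i`, so that every point of `W`, even near its
  -- edge, has a complete window and its translate nearby inside `W`.
  let L : ℕ → Finset Γ := fun i => insert 0 (K i ∪ (K i).image (· + v i))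
  refine ⟨m, fun i => Finset.image₂ (· - ·) (K i) (L i), fun n => ?_⟩
  obtain ⟨E, hE⟩ := hK n
  obtain ⟨N, hN, hNY⟩ := hH E
  obtain ⟨P, hP⟩ := exists_finset_not_le_stab hNY
  let W₀ : Finset Γ := P.biUnion fun p => (Finset.range (n + 1)).biUnion fun i =>
    {p.1 + v i, p.1 + p.2 + v i}
  obtain ⟨W, hW₀, hW⟩ := exists_finset_union_translates L
    (fun i => Finset.mem_insert_self _ _) W₀ (n + 1)
  obtain ⟨c, hc, hcK⟩ := hE N hN W
  refine ⟨W, c, fun y hy => ?_, fun i hi hvi w hw => ?_⟩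
  · obtain ⟨p, hp, hne⟩ := hP y hy
    refine ⟨_, _, hne, fun i hi => ?_⟩
    have hsub : ∀ x ∈ ({p.1 + v i, p.1 + p.2 + v i} : Finset Γ), x ∈ W := fun x hx =>
      hW₀ (Finset.mem_biUnion.mpr ⟨p, hp, Finset.mem_biUnion.mpr
        ⟨i, Finset.mem_range_succ_iff.mpr hi, hx⟩⟩)
    refine ⟨hsub _ (by simp), hsub _ (by simp), ?_⟩
    rw [add_right_comm, hc _ _ p.2.2]
  · obtain ⟨l, hl, h⟩ := hW i (Nat.lt_succ_of_le hi) w hw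
    have hu : ∀ k ∈ K i, w - l + k ∈ W ∧ w - l + k + v i ∈ W := fun k hk =>
      ⟨h k (by simp [L, hk]), by
        rw [add_assoc]
        refine h (k + v i) (Finset.mem_insert_of_mem (Finset.mem_union_right _ ?_))
        exact Finset.mem_image_of_mem _ hk⟩
    obtain ⟨k, hk, hne⟩ := hcK i hi hvi (w - l) hu
    have hwk : w + (k - l) = w - l + k := by abel
    refine ⟨k - l, Finset.mem_image₂_of_mem hk hl, ?_⟩
    rw [hwk]
    exact ⟨(hu k hk).1, (hu k hk).2, hne⟩

/-- If the subgroups that fix no point of `Y` are not generated upwards by finitely many of them,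
then they accumulate at a subgroup that fixes a point of `Y`. -/
theorem exists_limit_subgroup {Y : Subshift A Γ}
    (hY : ¬ ∃ 𝒢 : Set (AddSubgroup Γ), 𝒢.Finite ∧ (∀ N ∈ 𝒢, ∀ y ∈ Y.carrier, ¬ N ≤ stab y) ∧
      ∀ N : AddSubgroup Γ, (∀ y ∈ Y.carrier, ¬ N ≤ stab y) → ∃ G ∈ 𝒢, G ≤ N) :
    ∃ H : AddSubgroup Γ, (∃ y ∈ Y.carrier, H ≤ stab y) ∧
      ∀ E : Finset Γ, ∃ N : AddSubgroup Γ, (∀ e ∈ E, e ∈ N ↔ e ∈ H) ∧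
        ∀ y ∈ Y.carrier, ¬ N ≤ stab y := by
  classical
  let α := {N : AddSubgroup Γ // ∀ y ∈ Y.carrier, ¬ N ≤ stab y}
  let S : Set (Finset Γ) := {F | ∀ y ∈ Y.carrier, ¬ AddSubgroup.closure (F : Set Γ) ≤ stab y}
  -- The finite intersection property is the assumption `hY`: otherwise the subgroups generated by
  -- finitely many `F` in `S` would lie below all forbidden ones. `H` is the limit of the forbidden
  -- subgroups along the ultrafilter.
  obtain ⟨𝓤, h𝓤⟩ := Ultrafilter.exists_ultrafilter_of_finite_inter_nonempty
    ((fun F : Finset Γ => {N : α | ¬ (F : Set Γ) ⊆ N.1}) '' S) (by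
      intro T hT
      obtain ⟨T', hT', rfl⟩ := Finset.subset_set_image_iff.mp hT
      by_contra hne
      refine hY ⟨(fun F : Finset Γ => AddSubgroup.closure (F : Set Γ)) '' T',
        T'.finite_toSet.image _, ?_, fun N hN => ?_⟩
      · rintro _ ⟨F, hF, rfl⟩
        exact hT' hF
      · by_contra! hG
        refine hne ⟨⟨N, hN⟩, ?_⟩
        simp only [Finset.coe_image, Set.sInter_image, Set.mem_iInter]
        intro F hF hFN
        exact hG _ ⟨F, hF, rfl⟩ ((AddSubgroup.closure_le N).mpr hFN))
  let H : AddSubgroup Γ :=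
    { carrier := {x | ∀ᶠ N : α in 𝓤, x ∈ N.1}
      zero_mem' := Filter.Eventually.of_forall fun N => N.1.zero_mem
      add_mem' := fun {a b} ha hb => by
        filter_upwards [ha, hb] with N h1 h2 using N.1.add_mem h1 h2
      neg_mem' := fun {a} ha => by
        filter_upwards [ha] with N h1 using N.1.neg_mem h1 }
  refine ⟨H, ?_, fun E => ?_⟩
  -- If `H` fixed no point, compactness would give a finite `F` inside `H` with the same property.
  -- Then `F` is in `S`, yet it lies in `N` for almost all `N`.
  · by_contra! hH
    obtain ⟨P, hP⟩ := exists_finset_not_le_stab hH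
    let F : Finset Γ := P.image fun p => (p.2 : Γ)
    have hFS : F ∈ S := by
      intro y hy hle
      obtain ⟨p, hp, hne⟩ := hP y hy
      have := mem_stab.mp (hle (AddSubgroup.subset_closure
        (Finset.mem_coe.mpr (Finset.mem_image_of_mem _ hp)))) p.1
      rw [add_comm] at this
      exact hne this.symm
    have h1 : ∀ᶠ N : α in 𝓤, ¬ (F : Set Γ) ⊆ N.1 := h𝓤 ⟨F, hFS, rfl⟩
    have h2 : ∀ᶠ N : α in 𝓤, ∀ x ∈ F, x ∈ N.1 := by
      refine (Filter.eventually_all_finset F).mpr fun x hx => ?_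
      obtain ⟨p, -, rfl⟩ := Finset.mem_image.mp hx
      exact p.2.2
    obtain ⟨N, hN1, hN2⟩ := (h1.and h2).exists
    exact hN1 hN2
  · have : ∀ᶠ N : α in 𝓤, ∀ e ∈ E, (e ∈ N.1 ↔ e ∈ H) := by
      refine (Filter.eventually_all_finset E).mpr fun e _ => ?_
      by_cases he : e ∈ H
      · filter_upwards [show ∀ᶠ N : α in 𝓤, e ∈ N.1 from he] with N hN
        exact iff_of_true hN he
      · filter_upwards [Ultrafilter.eventually_not.mpr (show ¬ ∀ᶠ N : α in 𝓤, e ∈ N.1 from he)]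
          with N hN
        exact iff_of_false hN he
    obtain ⟨N, hN⟩ := this.exists
    exact ⟨N.1, hN, N.2⟩

end PeriodicPatterns

/-! ### From the map extension property to absolute retracts -/

section FreeClass

variable {Γ : Type v} [AddCommGroup Γ] {A : Type u} [Finite A] [TopologicalSpace A]
  [DiscreteTopology A]

/-- If subgroups fixing no point of `Y` accumulate at a subgroup fixing a point of `Y`, then there
is a subshift dominated by `Y` with points that are locally too periodic to be mapped into `Y`. -/
theorem not_mapExtensionProperty_of_limit_subgroup [Infinite Γ] [Countable Γ] {Y : Subshift A Γ}
    {H : AddSubgroup Γ} (hHY : ∃ y ∈ Y.carrier, H ≤ stab y)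
    (hH : ∀ E : Finset Γ, ∃ N : AddSubgroup Γ, (∀ e ∈ E, e ∈ N ↔ e ∈ H) ∧
      ∀ y ∈ Y.carrier, ¬ N ≤ stab y) :
    ¬ MapExtensionProperty Y := by
  classical
  intro hY
  obtain ⟨y, hy, hyH⟩ := hHY
  obtain ⟨v, hv⟩ := exists_surjective_nat Γ
  obtain ⟨m, M, hM⟩ := exists_patterns v hH
  choose W c hc₁ hc₂ using hM
  choose p hp using fun n => Infinite.exists_notMem_finset (W n)
  let _ : TopologicalSpace (Option (A ⊕ Fin m)) := ⊥
  have : DiscreteTopology (Option (A ⊕ Fin m)) := ⟨rfl⟩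
  -- The single `none` outside the window forces a trivial stabilizer wherever it is visible. Limits
  -- without it show either colors with all periods in `H`, or only a limit of translates of `y`.
  let x : ℕ → Γ → Option (A ⊕ Fin m) := fun n w =>
    if w ∈ W n then some (Sum.inr (c n w)) else if w = p n then none else some (Sum.inl (y w))
  have hxW : ∀ n, ∀ w ∈ W n, x n w = some (Sum.inr (c n w)) := fun n w hw => if_pos hw
  have hxp : ∀ n, x n (p n) = none := fun n => (if_neg (hp n)).trans (if_pos rfl)
  have hx_none : ∀ n w, x n w = none → w = p n := by
    intro n w h
    by_cases hw : w ∈ W n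
    · simp [x, hw] at h
    · by_contra hwp
      simp [x, hw, hwp] at h
  have hx_inr : ∀ n w a, x n w = some (Sum.inr a) → w ∈ W n := by
    intro n w a h
    by_contra hw
    by_cases hwp : w = p n <;> simp [x, hw, hwp, hp] at h
  have hx_inl : ∀ n w a, x n w = some (Sum.inl a) → a = y w := by
    intro n w a h
    by_cases hw : w ∈ W n
    · simp [x, hw] at h
    · by_cases hwp : w = p n
      · simp [x, hwp, hp] at h
      · simpa [x, hw, hwp] using h.symm
  let orbits : Set (Γ → Option (A ⊕ Fin m)) := {z | ∃ n g, shift g (x n) = z}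
  let X : Subshift (Option (A ⊕ Fin m)) Γ :=
    { carrier := closure orbits
      isClosed := isClosed_closure
      mapsTo := fun g => Set.MapsTo.closure (by
        rintro _ ⟨n, k, rfl⟩
        exact ⟨n, k + g, shift_add k g _⟩) (continuous_shift g) }
  have hX : ∀ z ∈ X.carrier, ∀ E : Finset Γ, ∃ n g, ∀ i ∈ E, x n (g + i) = z i := by
    intro z hz E
    obtain ⟨_, ⟨n, g, rfl⟩, h⟩ := mem_closure_iff_agree.mp hz E
    exact ⟨n, g, h⟩
  have hdom : StabDominated X Y := by
    intro z hz
    by_cases hstar : ∃ u₀, z u₀ = none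
    · obtain ⟨u₀, hu₀⟩ := hstar
      refine ⟨y, hy, fun w hw => ?_⟩
      obtain ⟨n, g, hg⟩ := hX z hz {u₀, w + u₀}
      have h1 := hx_none n _ ((hg u₀ (by simp)).trans hu₀)
      have h2 := hx_none n _ ((hg (w + u₀) (by simp)).trans ((mem_stab.mp hw u₀).trans hu₀))
      have : w = 0 := by simpa using h2.trans h1.symm
      exact this ▸ (stab y).zero_mem
    by_cases hcol : ∃ u₀ a, z u₀ = some (Sum.inr a)
    · obtain ⟨u₀, a, hu₀⟩ := hcol
      refine ⟨y, hy, le_trans (fun w hw => ?_) hyH⟩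
      obtain ⟨i, rfl⟩ := hv w
      by_contra hvi
      -- Only patterns with `n ≥ i` test the period `v i`. The last part of `E` contains every
      -- possible position of `none` relative to a colored point for `n < i`, so those `n` would
      -- make `none` visible.
      let E : Finset Γ := {u₀} ∪ (M i).image (u₀ + ·) ∪ (M i).image (fun t => v i + (u₀ + t)) ∪
        (Finset.range i).biUnion fun n => (W n).image fun w => p n - w + u₀
      obtain ⟨n, g, hg⟩ := hX z hz E
      have hgW : g + u₀ ∈ W n := hx_inr n _ a ((hg u₀ (by simp [E])).trans hu₀)
      obtain hn | hn := lt_or_ge n i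
      · have hmem : p n - (g + u₀) + u₀ ∈ E := Finset.mem_union_right _
          (Finset.mem_biUnion.mpr ⟨n, Finset.mem_range.mpr hn, Finset.mem_image.mpr
            ⟨_, hgW, rfl⟩⟩)
        have h := hg _ hmem
        rw [show g + (p n - (g + u₀) + u₀) = p n by abel, hxp] at h
        exact hstar ⟨_, h.symm⟩
      · obtain ⟨t, ht, h1, h2, hne⟩ := hc₂ n i hn hvi _ hgW
        have e1 := hg (u₀ + t) (by
          refine Finset.mem_union_left _ (Finset.mem_union_left _ (Finset.mem_union_right _ ?_))
          exact Finset.mem_image_of_mem _ ht)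
        have e2 := hg (v i + (u₀ + t)) (by
          refine Finset.mem_union_left _ (Finset.mem_union_right _ ?_)
          exact Finset.mem_image.mpr ⟨t, ht, rfl⟩)
        rw [mem_stab.mp hw, ← e1, ← add_assoc g u₀ t, hxW n _ h1,
          show g + (v i + (u₀ + t)) = g + u₀ + t + v i by abel, hxW n _ h2] at e2
        simp only [Option.some.injEq, Sum.inr.injEq] at e2
        exact hne e2.symm
    · have hbase : ∀ w, ∃ a, z w = some (Sum.inl a) := by
        intro w
        rcases h : z w with _ | a | a
        · exact absurd ⟨w, h⟩ hstar
        · exact ⟨a, rfl⟩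
        · exact absurd ⟨w, a, h⟩ hcol
      choose z' hz' using hbase
      refine ⟨z', ?_, fun w hw => mem_stab.mpr fun u => ?_⟩
      · rw [← Y.isClosed.closure_eq, mem_closure_iff_agree]
        intro E
        obtain ⟨n, g, hg⟩ := hX z hz E
        exact ⟨shift g y, Y.mapsTo g hy, fun i hi =>
          (hx_inl n _ _ ((hg i hi).trans (hz' i))).symm⟩
      · have := mem_stab.mp hw u
        rw [hz', hz'] at this
        simpa using this
  -- Extending from the empty subshift already yields a contradiction: no map from `X` to `Y` exists
  -- at all.
  let X' : Subshift (Option (A ⊕ Fin m)) Γ := ⟨∅, isClosed_empty, fun _ => Set.mapsTo_empty _ _⟩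
  have : IsEmpty X'.carrier := Set.isEmpty_coe_sort.mpr rfl
  obtain ⟨q, -⟩ := hY (Option (A ⊕ Fin m)) X X' (Set.empty_subset _) hdom
    ⟨isEmptyElim, continuous_of_const fun x => isEmptyElim x, fun _ x => isEmptyElim x⟩
  obtain ⟨E, hE⟩ := exists_window X.isClosed.isCompact
    (f := fun z => (q.toFun z : Γ → A) 0)
    ((continuous_apply 0).comp (continuous_subtype_val.comp q.continuous_toFun))
  choose ν hν using hv
  have hxX : ∀ n g, shift g (x n) ∈ X.carrier := fun n g => subset_closure ⟨n, g, rfl⟩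
  -- With this `n`, every element of the coding window `E` is some `v i` with `i ≤ n`, so the
  -- pattern looks the same from `u` and `u'` through `E`.
  let n := E.sup ν
  have hval : ∀ u, (q.toFun ⟨shift u (x n), hxX n u⟩ : Γ → A) 0 =
      (q.toFun ⟨x n, shift_zero (x n) ▸ hxX n 0⟩ : Γ → A) u := by
    intro u
    rw [q.equivariant u ⟨x n, shift_zero (x n) ▸ hxX n 0⟩, shift_apply, add_zero]
  obtain ⟨u, u', hne, huu'⟩ := hc₁ n _ (q.toFun ⟨x n, shift_zero (x n) ▸ hxX n 0⟩).2
  refine hne ?_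
  rw [← hval, ← hval]
  refine hE _ _ fun e he => ?_
  obtain ⟨h1, h2, h3⟩ := huu' (ν e) (Finset.le_sup he)
  rw [hν] at h1 h2 h3
  simp only [shift_apply]
  rw [hxW n _ h1, hxW n _ h2, h3]

/-- The subgroups that fix no point of a subshift with the map extension property are generated
upwards by finitely many of them. -/
theorem MapExtensionProperty.exists_finite [Countable Γ] {Y : Subshift A Γ}
    (hY : MapExtensionProperty Y) :
    ∃ 𝒢 : Set (AddSubgroup Γ), 𝒢.Finite ∧ (∀ N ∈ 𝒢, ∀ y ∈ Y.carrier, ¬ N ≤ stab y) ∧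
      ∀ N : AddSubgroup Γ, (∀ y ∈ Y.carrier, ¬ N ≤ stab y) → ∃ G ∈ 𝒢, G ≤ N := by
  -- A finite group has only finitely many subgroups; the construction for infinite `Γ` needs room
  -- outside each window for `none`.
  obtain _ | _ := finite_or_infinite Γ
  · exact ⟨{N | ∀ y ∈ Y.carrier, ¬ N ≤ stab y}, Set.toFinite _, fun _ hN => hN,
      fun N hN => ⟨N, hN, le_rfl⟩⟩
  · by_contra hno
    obtain ⟨H, hHY, hH⟩ := exists_limit_subgroup hno
    exact not_mapExtensionProperty_of_limit_subgroup hHY hH hY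

theorem MapExtensionProperty.isAbsoluteRetractFor {Y : Subshift A Γ}
    (hY : MapExtensionProperty Y) {𝒢 : Set (AddSubgroup Γ)}
    (h𝒢 : ∀ N ∈ 𝒢, ∀ y ∈ Y.carrier, ¬ N ≤ stab y)
    (hup : ∀ N : AddSubgroup Γ, (∀ y ∈ Y.carrier, ¬ N ≤ stab y) → ∃ G ∈ 𝒢, G ≤ N) :
    IsAbsoluteRetractFor (GFree 𝒢) Y := by
  refine ⟨fun y hy N hN => h𝒢 N hN y hy, fun B _ _ _ X hX e he => ?_⟩
  have hsub : e.range.carrier ⊆ X.carrier := by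
    rintro _ ⟨y, rfl⟩
    exact (e.toFun y).2
  have hdom : StabDominated X Y := by
    intro x hx
    by_contra! hno
    obtain ⟨G, hG, hle⟩ := hup _ hno
    exact hX x hx G hG hle
  obtain ⟨p', hp'⟩ := e.exists_leftInverse he
  obtain ⟨p, hp⟩ := hY B X e.range hsub hdom p'
  let e' : SubshiftMap Y e.range :=
    { toFun := fun y => ⟨e.toFun y, y, rfl⟩
      continuous_toFun := (continuous_subtype_val.comp e.continuous_toFun).subtype_mk _
      equivariant := e.equivariant }
  refine ⟨hsub, e'.comp p, fun y hy => ?_⟩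
  change (e.toFun (p.toFun ⟨y, hsub hy⟩) : Γ → B) = y
  rw [hp y hy]
  exact hp' ⟨y, hy⟩

end FreeClass

end SubshiftRetract

theorem mainTheorem6 {Γ : Type*} [AddCommGroup Γ] [Countable Γ]
    {A : Type*} [Finite A] [TopologicalSpace A] [DiscreteTopology A]
    (Y : SymbolicDynamics.FullShift.Subshift A Γ) :
    SubshiftRetract.MapExtensionProperty Y ↔
      ∃ 𝒢 : Set (AddSubgroup Γ), 𝒢.Finite ∧
        SubshiftRetract.IsAbsoluteRetractFor (SubshiftRetract.GFree 𝒢) Y := by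
  constructor
  · intro hY
    obtain ⟨𝒢, hfin, h𝒢, hup⟩ := hY.exists_finite
    exact ⟨𝒢, hfin, hY.isAbsoluteRetractFor h𝒢 hup⟩
  · rintro ⟨𝒢, hfin, hY⟩
    exact SubshiftRetract.mapExtensionProperty_of_isAbsoluteRetractFor hfin hY
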